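/- Let $\Omega=\{(x,y)\in\mathbb{R}^2: x>0\}$. For $k\in\mathbb{R}$ let $\mathfrak h(k)=-\frac{d^2}{dx^2}+(x-k)^2$ in $L^2(0,\infty)$ with a Dirichlet condition at $x=0$; let $\lambda_1(k)<\lambda_2(k)<\dots$ be its (simple) eigenvalues and $u_n(\cdot,k)$, $n\ge 1$, corresponding eigenfunctions of norm one in $L^2(0,\infty)$. Put $E_n=2n-1$; $\lambda_n$ is a decreasing real-analytic diffeomorphism of $\mathbb{R}$ onto $I_n=(E_n,\infty)$; put $\mu_n=|\lambda_n'\circ\lambda_n^{-1}|^{-1/2}$ on $I_n$. For $s>1/2$ let $L^{2,s}(\Omega)$ be the space of measurable $f:\Omega\to\mathbb{C}$ with $(1+y^2)^{s/2}f\in L^2(\Omega)$, and for $f\in L^{2,s}(\Omega)$ let $$f_n(k)=\int_0^\infty \Big(\frac1{\sqrt{2\pi}}\int_{\mathbb{R}}e^{-iky}f(x,y)\,dy\Big)\overline{u_n(x,k)}\,dx,\qquad k\in\mathbb{R}.$$ For $\alpha\ge 0$ let $\mathcal X_{n,0}^{s,\alpha}(\Omega)$ be the set of $f\in L^{2,s}(\Omega)$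 such that $\mu_n\,(f_n\circ\lambda_n^{-1})$ belongs to $L^2(I_n)$ and extends from $I_n$ to a function in $C^{0,\alpha}([E_n,\infty))$ (bounded, continuous, and Hölder continuous of exponent $\alpha$) that vanishes at $E_n$. Finally let $$w_n^\alpha(k)=|\lambda_n(k)-E_n|^{-\alpha}\,|\lambda_n'(k)|^{-1/2},\qquad k\in\mathbb{R}.$$ **Proposition.** For all integers $n\ge1$, all $s\in(1/2,\infty)$, all $\alpha\in[0,\min(1,s-1/2))$ and all $f\in\mathcal X_{n,0}^{s,\alpha}(\Omega)$, one has $w_n^\alpha f_n\in L^\infty(\mathbb{R})$; moreover there is a constant $C$ with $|w_n^\alpha(k)f_n(k)|\le C$ for every $k\in\mathbb{R}$. -/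

import Mathlib

open MeasureTheory Set
open scoped NNReal ENNReal ComplexConjugate

noncomputable section

namespace HalfPlane

/-- The half-plane `{(x, y) : x > 0}`. -/
def Omega : Set (ℝ × ℝ) := {p | 0 < p.1}

/-- The weighted space `L^{2,σ}` on the half-plane: `(1 + y²)^(σ/2) f` is square integrable. The
weight is continuous and positive, so measurability of `f` is included. -/
def weightedL2 (σ : ℝ) : Set (ℝ × ℝ → ℂ) :=
  {f | MemLp (fun p : ℝ × ℝ => (((1 + p.2 ^ 2) ^ (σ / 2) : ℝ) : ℂ) * f p) 2
    (volume.restrict Omega)}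

/-- The graph of the fiber operator `-d²/dx² + (x - k)²` in `L²(0, ∞)` with a Dirichlet condition
at `0`: `u` and `g` are in `L²(0, ∞)`, `u` and its derivative `v` are locally absolutely continuous
on `[0, ∞)`, `u 0 = 0`, and `-u'' + (x - k)² u = g` almost everywhere on `(0, ∞)`. Both absolute
continuity statements are written as integral equations, and `u` is the continuous representative
of its class. All integrands below are locally integrable on `[0, ∞)`. -/
def FiberOperator (k : ℝ) (u g : ℝ → ℂ) : Prop :=
  MemLp u 2 (volume.restrict (Ioi 0)) ∧ MemLp g 2 (volume.restrict (Ioi 0)) ∧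
    ∃ v : ℝ → ℂ,
      (∀ x, 0 ≤ x → u x = ∫ t in (0 : ℝ)..x, v t) ∧
      (∀ x, 0 ≤ x →
        v x = v 0 + ∫ t in (0 : ℝ)..x, ((((t - k) ^ 2 : ℝ) : ℂ) * u t - g t))

/-- `u` is an eigenfunction, of norm one in `L²(0, ∞)`, of the fiber operator at `k`, with
eigenvalue `lam`. -/
def IsNormalizedEigenfunction (k lam : ℝ) (u : ℝ → ℂ) : Prop :=
  FiberOperator k u (fun x => (lam : ℂ) * u x) ∧ ∫ x in Ioi (0 : ℝ), ‖u x‖ ^ 2 = 1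

/-- The set of eigenvalues of the fiber operator at `k`. -/
def eigenvalues (k : ℝ) : Set ℝ := {lam | ∃ u, IsNormalizedEigenfunction k lam u}

/-- The band function: `bandFun n k` is the `n`-th eigenvalue (`n ≥ 1`, increasing order) of the
fiber operator at `k`, that is, the least eigenvalue `lam` such that at least `n` eigenvalues are
`≤ lam`. The eigenvalues are simple, because an eigenfunction is determined by its derivative at
the origin, so no multiplicity has to be counted. -/
def bandFun (n : ℕ) (k : ℝ) : ℝ :=
  sInf {lam | lam ∈ eigenvalues k ∧ (n : ℕ∞) ≤ (eigenvalues k ∩ Iic lam).encard}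

/-- The Landau level `E_n = 2 n - 1`, the limit of the `n`-th band function at `+∞`. -/
def landau (n : ℕ) : ℝ := 2 * (n : ℝ) - 1

/-- A choice `u n x k` of normalized eigenfunctions, `u n · k` belonging to the `n`-th eigenvalue
of the fiber operator at `k`. -/
def IsEigenfunctionFamily (u : ℕ → ℝ → ℝ → ℂ) : Prop :=
  ∀ n, 1 ≤ n → ∀ k, IsNormalizedEigenfunction k (bandFun n k) (fun x => u n x k)

/-- The unitary partial Fourier transform in the longitudinal variable `y`. For `f` in
`weightedL2 s` with `s > 1/2`, `f (x, ·)` is integrable for almost every `x > 0`, so this integral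
is an honest one, for every `k`. -/
def partialFourier (f : ℝ × ℝ → ℂ) (x k : ℝ) : ℂ :=
  ((Real.sqrt (2 * Real.pi))⁻¹ : ℂ) * ∫ y : ℝ, Complex.exp (-(Complex.I * k * y)) * f (x, y)

/-- The `n`-th Fourier coefficient `f_n` of `f`. -/
def fourierCoefficient (u : ℕ → ℝ → ℝ → ℂ) (n : ℕ) (f : ℝ × ℝ → ℂ) (k : ℝ) : ℂ :=
  ∫ x in Ioi (0 : ℝ), partialFourier f x k * conj (u n x k)

/-- The inverse function of `bandFun n`, which is a bijection from `ℝ` onto `(E_n, ∞)`. -/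
def bandInv (n : ℕ) : ℝ → ℝ := Function.invFun (bandFun n)

/-- The weight `μ_n = |λ_n' ∘ λ_n⁻¹|^(-1/2)` on `(E_n, ∞)`. -/
def muWeight (n : ℕ) (lam : ℝ) : ℝ := |deriv (bandFun n) (bandInv n lam)| ^ (-(1 / 2) : ℝ)

/-- The space `C^{0,α}(S)` of bounded, continuous, `α`-Hölder continuous functions on `S`. -/
def IsHolderSpace (α : ℝ) (S : Set ℝ) (g : ℝ → ℂ) : Prop :=
  ContinuousOn g S ∧ (∃ M : ℝ, ∀ x ∈ S, ‖g x‖ ≤ M) ∧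
    ∃ C : ℝ≥0, HolderOnWith C α.toNNReal g S

/-- `μ_n (f_n ∘ λ_n⁻¹)`, a function on `(E_n, ∞)`. -/
def weightedCoefficient (u : ℕ → ℝ → ℝ → ℂ) (n : ℕ) (f : ℝ × ℝ → ℂ) (lam : ℝ) : ℂ :=
  (muWeight n lam : ℂ) * fourierCoefficient u n f (bandInv n lam)

/-- The absorption space `X_{n,0}^{s,α}`: the `f` in `L^{2,s}` such that `μ_n (f_n ∘ λ_n⁻¹)` is
in `L²(E_n, ∞)` and extends from `(E_n, ∞)` to a function in `C^{0,α}([E_n, ∞))` that vanishes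
at `E_n`. -/
def absorptionSpace (u : ℕ → ℝ → ℝ → ℂ) (n : ℕ) (s α : ℝ) : Set (ℝ × ℝ → ℂ) :=
  {f | f ∈ weightedL2 s ∧
    MemLp (weightedCoefficient u n f) 2 (volume.restrict (Ioi (landau n))) ∧
    ∃ g : ℝ → ℂ, (∀ lam ∈ Ioi (landau n), g lam = weightedCoefficient u n f lam) ∧
      IsHolderSpace α (Ici (landau n)) g ∧ g (landau n) = 0}

/-- The weight `w_n^α(k) = |λ_n(k) - E_n|^(-α) |λ_n'(k)|^(-1/2)`. -/
def wWeight (n : ℕ) (α k : ℝ) : ℝ :=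
  |bandFun n k - landau n| ^ (-α) * |deriv (bandFun n) k| ^ (-(1 / 2) : ℝ)

end HalfPlane

end

/-!
Substituting `lam = bandFun n k` turns `w_n^α(k) f_n(k)` into `(lam - E_n)^(-α) g(lam)`, where `g`
is the Hölder continuous extension of `μ_n (f_n ∘ λ_n⁻¹)`; since `g` vanishes at `E_n`, the Hölder
constant of `g` bounds this quotient. The substitution is legitimate because `λ_n` is strictly
decreasing and exceeds `E_n`.

Both facts come from the Prüfer angle of the Dirichlet problem for `-φ'' + x² φ` on `(-k, ∞)`, the
translate of the fiber operator. The eigenvalue with index `i` is the infimum of the spectral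
parameters whose angle passes `(i + 1) π`. Moving the endpoint to the left advances the angle, so
the eigenvalues decrease in `k`. Comparison with the `i`-th Hermite function, which has at most `i`
zeros on the half-line, shows that they exceed `2 i + 1`.
-/

noncomputable section

namespace HalfPlane

open Real Filter Topology

theorem lt_of_hasDerivAt_of_barrier {f f' : ℝ → ℝ} {a x c : ℝ} (hf : ∀ x, HasDerivAt f (f' x) x)
    (ha : c ≤ f a) (hb : ∀ x, a ≤ x → f x = c → 0 < f' x) (hx : a < x) : c < f x := by
  have hle : ∀ y, a ≤ y → c ≤ f y := fun y hy =>
    image_le_of_deriv_right_lt_deriv_boundary' (f := fun _ => c) (f' := fun _ => 0)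
      (B := f) (B' := f') continuousOn_const (fun z _ => hasDerivWithinAt_const _ _ _) ha
      (fun z _ => (hf z).continuousAt.continuousWithinAt)
      (fun z _ => (hf z).hasDerivWithinAt) (fun z hz h => hb z hz.1 h.symm) ⟨hy, le_rfl⟩
  refine (hle x hx.le).lt_of_ne fun heq => ?_
  have hslope : ∀ᶠ z in 𝓝[<] x, 0 < slope f x z :=
    (hasDerivAt_iff_tendsto_slope_left_right.1 (hf x)).1.eventually_const_lt
      (hb x hx.le heq.symm)
  obtain ⟨z, hz, haz, hzx⟩ := (hslope.and (Ioo_mem_nhdsLT hx)).exists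
  rw [slope_def_field, ← heq] at hz
  exact hz.not_ge (div_nonpos_of_nonneg_of_nonpos (sub_nonneg.2 (hle z haz.le))
    (sub_nonpos.2 hzx.le))

theorem hasDerivAt_integral_of_continuous {E : Type*} [NormedAddCommGroup E] [NormedSpace ℝ E]
    [CompleteSpace E] {m : ℝ → E} (hm : Continuous m) (a x : ℝ) :
    HasDerivAt (fun x => ∫ t in a..x, m t) (m x) x :=
  intervalIntegral.integral_hasDerivAt_right (hm.intervalIntegrable _ _)
    (hm.stronglyMeasurableAtFilter _ _) hm.continuousAt

theorem monotone_mul_exp_neg_integral {f f' m : ℝ → ℝ} (hm : Continuous m)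
    (hf : ∀ x, HasDerivAt f (f' x) x) (h : ∀ x, m x * f x ≤ f' x) (a : ℝ) :
    Monotone fun x => f x * exp (-∫ t in a..x, m t) := by
  refine monotone_of_hasDerivAt_nonneg
    (fun x => (hf x).mul (hasDerivAt_integral_of_continuous hm a x).neg.exp) fun x => ?_
  have hexp := mul_le_mul_of_nonneg_right (h x) (exp_pos (-∫ t in a..x, m t)).le
  simp only [Pi.zero_apply, Pi.neg_apply]
  linarith

theorem not_forall_sq_le_deriv {δ δ' : ℝ → ℝ} {X : ℝ} (hδ : ∀ x, X ≤ x → 0 < δ x)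
    (hd : ∀ x, X ≤ x → HasDerivAt δ (δ' x) x) : ¬ ∀ x, X ≤ x → δ x ^ 2 ≤ δ' x := by
  intro h
  have hder : ∀ x, X ≤ x → HasDerivAt (fun x => (δ x)⁻¹ + x) (-δ' x / δ x ^ 2 + 1) x :=
    fun x hx => ((hd x hx).fun_inv (hδ x hx).ne').fun_add (hasDerivAt_id x)
  have hanti : AntitoneOn (fun x => (δ x)⁻¹ + x) (Ici X) := by
    refine antitoneOn_of_hasDerivWithinAt_nonpos (convex_Ici X)
      (fun x hx => (hder x hx).continuousAt.continuousWithinAt)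
      (fun x hx => (hder x (interior_subset hx)).hasDerivWithinAt) fun x hx => ?_
    have hx : X ≤ x := interior_subset hx
    have : 1 ≤ δ' x / δ x ^ 2 := (one_le_div (pow_pos (hδ x hx) 2)).2 (h x hx)
    rw [neg_div]
    linarith
  have hX : X ≤ X + (δ X)⁻¹ := le_add_of_nonneg_right (inv_pos.2 (hδ X le_rfl)).le
  have hle : (δ (X + (δ X)⁻¹))⁻¹ + (X + (δ X)⁻¹) ≤ (δ X)⁻¹ + X := hanti self_mem_Ici hX hX
  linarith [inv_pos.2 (hδ _ hX)]

theorem exists_forall_hasDerivAt {E : Type*} [NormedAddCommGroup E] [NormedSpace ℝ E]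
    [CompleteSpace E] {f : ℝ → E → E} (hcont : ∀ y, Continuous fun t => f t y)
    (hlip : ∀ b c : ℝ, ∃ K : ℝ≥0, ∀ t ∈ Icc b c, LipschitzWith K (f t))
    (hbdd : ∀ b c : ℝ, ∃ C : ℝ≥0, ∀ t ∈ Icc b c, ∀ y, ‖f t y‖ ≤ C) (a : ℝ) (y : E) :
    ∃ θ : ℝ → E, θ a = y ∧ ∀ x, HasDerivAt θ (f x (θ x)) x := by
  have hlocal : ∀ N : ℝ, ∃ θ : ℝ → E, 0 ≤ N → θ a = y ∧
      ∀ x ∈ Ioo (a - N) (a + N), HasDerivAt θ (f x (θ x)) x := by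
    intro N
    by_cases hN : 0 ≤ N
    swap
    · exact ⟨0, fun h => absurd h hN⟩
    obtain ⟨K, hK⟩ := hlip (a - N) (a + N)
    obtain ⟨C, hC⟩ := hbdd (a - N) (a + N)
    have hpl : IsPicardLindelof f (tmin := a - N) (tmax := a + N)
        ⟨a, by constructor <;> linarith⟩ y (C * ⟨N, hN⟩) 0 C K :=
      ⟨fun t ht => (hK t ht).lipschitzOnWith, fun y _ => (hcont y).continuousOn,
        fun t ht y _ => hC t ht y, by simp; rfl⟩
    obtain ⟨θ, ha, hθ⟩ := hpl.exists_eq_forall_mem_Icc_hasDerivWithinAt₀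
    exact ⟨θ, fun _ => ⟨ha, fun x hx =>
      (hθ x (Ioo_subset_Icc_self hx)).hasDerivAt (Icc_mem_nhds hx.1 hx.2)⟩⟩
  choose θ hθ using hlocal
  have hagree : ∀ N M : ℝ, 0 < N → N ≤ M → EqOn (θ N) (θ M) (Ioo (a - N) (a + N)) := by
    intro N M hN hNM
    obtain ⟨hNa, hN'⟩ := hθ N hN.le
    obtain ⟨hMa, hM'⟩ := hθ M (hN.le.trans hNM)
    obtain ⟨K, hK⟩ := hlip (a - N) (a + N)
    exact ODE_solution_unique_of_mem_Ioo (t₀ := a) (K := K) (s := fun _ => univ) (v := f)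
      (fun t ht => (hK t (Ioo_subset_Icc_self ht)).lipschitzOnWith)
      ⟨by linarith, by linarith⟩ (fun t ht => ⟨hN' t ht, trivial⟩)
      (fun t ht => ⟨hM' t ⟨by linarith [ht.1], by linarith [ht.2]⟩, trivial⟩) (hNa.trans hMa.symm)
  refine ⟨fun x => θ (|x - a| + 1) x, (hθ _ (by positivity)).1, fun x => ?_⟩
  have hx : x ∈ Ioo (a - (|x - a| + 1)) (a + (|x - a| + 1)) :=
    ⟨by linarith [neg_abs_le (x - a)], by linarith [le_abs_self (x - a)]⟩
  have hdiff := (hθ (|x - a| + 2) (by positivity)).2 x ⟨by linarith [hx.1], by linarith [hx.2]⟩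
  simp only [hagree _ (|x - a| + 2) (by positivity) (by linarith) hx]
  refine hdiff.congr_of_eventuallyEq ?_
  filter_upwards [Metric.ball_mem_nhds x one_pos] with z hz
  rw [Metric.mem_ball, dist_eq] at hz
  have hza : |z - a| ≤ |z - x| + |x - a| := abs_sub_le z x a
  exact hagree _ _ (by positivity) (by linarith)
    ⟨by linarith [neg_abs_le (z - a)], by linarith [le_abs_self (z - a)]⟩

theorem not_integrableOn_Ioi_of_monotoneOn {f : ℝ → ℝ} {X : ℝ} (hf : MonotoneOn f (Ici X))
    (hX : 0 < f X) : ¬ IntegrableOn f (Ioi X) := by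
  intro h
  have hle : ∀ x ∈ Ioi X, ‖f X‖ ≤ ‖f x‖ := fun x hx => by
    have := hf self_mem_Ici (mem_Ici.2 (le_of_lt hx)) (le_of_lt hx)
    rwa [norm_of_nonneg hX.le, norm_of_nonneg (hX.le.trans this)]
  have hconst : IntegrableOn (fun _ : ℝ => f X) (Ioi X) :=
    Integrable.mono h aestronglyMeasurable_const
      ((ae_restrict_iff' measurableSet_Ioi).2 (ae_of_all _ hle))
  rw [integrableOn_const_iff] at hconst
  simp [hX.ne'] at hconst

theorem integrableOn_Ioi_of_le_deriv {f g g' : ℝ → ℝ} {X B : ℝ} (hf : Continuous f)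
    (hg : ∀ x, X ≤ x → HasDerivAt g (g' x) x) (hf0 : ∀ x, X ≤ x → 0 ≤ f x)
    (hfg : ∀ x, X ≤ x → f x ≤ g' x) (hB : ∀ x, X ≤ x → g x ≤ B) : IntegrableOn f (Ioi X) := by
  refine integrableOn_Ioi_of_intervalIntegral_norm_bounded (B - g X) X
    (fun i : ℝ => hf.continuousOn.integrableOn_Icc.mono_set Ioc_subset_Icc_self) tendsto_id
    ((eventually_ge_atTop X).mono fun x hx => ?_)
  have hnorm : ∫ t in X..x, ‖f t‖ = ∫ t in X..x, f t :=
    intervalIntegral.integral_congr fun t ht => by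
      rw [uIcc_of_le hx] at ht
      exact norm_of_nonneg (hf0 t ht.1)
  have hle : (∫ t in X..x, f t) ≤ g x - g X :=
    intervalIntegral.integral_le_sub_of_hasDeriv_right_of_le hx
      (fun t ht => (hg t ht.1).continuousAt.continuousWithinAt)
      (fun t ht => (hg t ht.1.le).hasDerivWithinAt) (hf.continuousOn.integrableOn_Icc)
      (fun t ht => hfg t ht.1.le)
  simp only [id_eq, hnorm]
  linarith [hB x hx]

theorem sInf_range_encard_eq {α : Type*} [ConditionallyCompleteLinearOrder α] {g : ℕ → α}
    (hg : StrictMono g) (n : ℕ) :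
    sInf {a | a ∈ range g ∧ ((n + 1 : ℕ) : ℕ∞) ≤ (range g ∩ Iic a).encard} = g n := by
  have hset : {a | a ∈ range g ∧ ((n + 1 : ℕ) : ℕ∞) ≤ (range g ∩ Iic a).encard}
      = g '' Ici n := by
    have hcount : ∀ i, range g ∩ Iic (g i) = g '' Iic i := fun i => by
      ext a
      constructor
      · rintro ⟨⟨j, rfl⟩, hj⟩
        exact ⟨j, hg.le_iff_le.1 hj, rfl⟩
      · rintro ⟨j, hj, rfl⟩
        exact ⟨mem_range_self j, hg.monotone hj⟩
    have hcard : ∀ i, (range g ∩ Iic (g i)).encard = ((i + 1 : ℕ) : ℕ∞) := fun i => by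
      rw [hcount, hg.injective.encard_image, ← Finset.coe_Iic, encard_coe_eq_coe_finsetCard,
        Nat.card_Iic]
    ext a
    constructor
    · rintro ⟨⟨i, rfl⟩, hi⟩
      rw [hcard, Nat.cast_le] at hi
      exact ⟨i, Nat.le_of_succ_le_succ hi, rfl⟩
    · rintro ⟨i, hi, rfl⟩
      refine ⟨mem_range_self i, ?_⟩
      rw [hcard, Nat.cast_le]
      exact Nat.succ_le_succ hi
  rw [hset]
  exact ((hg.monotone.monotoneOn _).map_isLeast isLeast_Ici).csInf_eq

theorem sin_sq_sub_sin_sq (s t : ℝ) : sin s ^ 2 - sin t ^ 2 = sin (s - t) * sin (s + t) := by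
  rw [sin_sub, sin_add]
  linear_combination (-sin s ^ 2) * sin_sq_add_cos_sq t + sin t ^ 2 * sin_sq_add_cos_sq s

theorem abs_sin_sq_sub_sin_sq_le (s t : ℝ) : |sin s ^ 2 - sin t ^ 2| ≤ |s - t| := by
  rw [sin_sq_sub_sin_sq, abs_mul]
  exact (mul_le_of_le_one_right (abs_nonneg _) (abs_sin_le_one _)).trans abs_sin_le_abs

theorem cos_sq_of_sin_eq_zero {c : ℝ} (hc : sin c = 0) : cos c ^ 2 = 1 := by
  rw [cos_sq', hc]
  norm_num

theorem sin_mul_cos_add {c : ℝ} (hc : sin c = 0) (t : ℝ) :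
    sin (c + t) * cos (c + t) = sin t * cos t := by
  rw [sin_add, cos_add, hc]
  linear_combination sin t * cos t * cos_sq_of_sin_eq_zero hc

theorem sin_mul_cos_nonneg {c s : ℝ} (hc : sin c = 0) (hs : s ∈ Icc c (c + π / 2)) :
    0 ≤ sin s * cos s := by
  rw [← add_sub_cancel c s, sin_mul_cos_add hc]
  exact mul_nonneg (sin_nonneg_of_nonneg_of_le_pi (by linarith [hs.1])
    (by linarith [hs.2, pi_pos])) (cos_nonneg_of_neg_pi_div_two_le_of_le
    (by linarith [hs.1, pi_pos]) (by linarith [hs.2]))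

theorem sin_mul_cos_nonpos {c s : ℝ} (hc : sin c = 0) (hs : s ∈ Icc (c - π / 2) c) :
    sin s * cos s ≤ 0 := by
  rw [← add_sub_cancel c s, sin_mul_cos_add hc]
  exact mul_nonpos_of_nonpos_of_nonneg (sin_nonpos_of_nonpos_of_neg_pi_le (by linarith [hs.2])
    (by linarith [hs.1, pi_pos])) (cos_nonneg_of_neg_pi_div_two_le_of_le
    (by linarith [hs.1]) (by linarith [hs.2, pi_pos]))

theorem sin_mul_sin_pos {c s t : ℝ} (hc : sin c = 0) (hs : s ∈ Ioo (c - π) c)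
    (ht : t ∈ Ioo (c - π) c) : 0 < sin s * sin t := by
  have hneg : ∀ r ∈ Ioo (c - π) c, sin (r - c) < 0 := fun r hr =>
    sin_neg_of_neg_of_neg_pi_lt (by linarith [hr.2]) (by linarith [hr.1])
  have hprod : sin (s - c) * sin (t - c) = sin s * sin t := by
    rw [sin_sub, sin_sub, hc]
    linear_combination sin s * sin t * cos_sq_of_sin_eq_zero hc
  exact hprod ▸ mul_pos_of_neg_of_neg (hneg s hs) (hneg t ht)

theorem cot_sub_cot {s t : ℝ} (hs : sin s ≠ 0) (ht : sin t ≠ 0) :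
    cot s - cot t = sin (t - s) / (sin s * sin t) := by
  rw [cot_eq_cos_div_sin, cot_eq_cos_div_sin, div_sub_div _ _ hs ht, sin_sub]
  ring

/-- `θ` is a Prüfer angle of the equation `φ'' = p φ`: in polar coordinates `φ = A sin θ`,
`φ' = A cos θ`, the equation for the angle separates from the one for the amplitude `A`. -/
def IsPruferAngle (p θ : ℝ → ℝ) : Prop :=
  ∀ x, HasDerivAt θ (cos (θ x) ^ 2 - p x * sin (θ x) ^ 2) x

theorem lipschitzWith_pruferField {p : ℝ} {K : ℝ≥0} (hp : |1 + p| ≤ K) :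
    LipschitzWith K fun s => cos s ^ 2 - p * sin s ^ 2 :=
  LipschitzWith.of_dist_le_mul fun s t => by
    have hdiff : cos s ^ 2 - p * sin s ^ 2 - (cos t ^ 2 - p * sin t ^ 2)
        = -(1 + p) * (sin s ^ 2 - sin t ^ 2) := by
      rw [cos_sq', cos_sq']
      ring
    rw [dist_eq, dist_eq, hdiff, abs_mul, abs_neg]
    exact mul_le_mul hp (abs_sin_sq_sub_sin_sq_le s t) (abs_nonneg _) K.2

theorem exists_abs_one_add_le {p : ℝ → ℝ} (hp : Continuous p) (b c : ℝ) :
    ∃ K : ℝ≥0, ∀ x ∈ Icc b c, |1 + p x| ≤ K := by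
  obtain ⟨K, hK⟩ := isCompact_Icc.exists_bound_of_continuousOn
    (continuous_const.add hp).continuousOn
  exact ⟨K.toNNReal, fun x hx => (hK x hx).trans (le_coe_toNNReal K)⟩

theorem exists_isPruferAngle {p : ℝ → ℝ} (hp : Continuous p) (a y : ℝ) :
    ∃ θ, θ a = y ∧ IsPruferAngle p θ := by
  refine exists_forall_hasDerivAt (f := fun x s => cos s ^ 2 - p x * sin s ^ 2)
    (fun s => by fun_prop) (fun b c => ?_) (fun b c => ?_) a y
  · obtain ⟨K, hK⟩ := exists_abs_one_add_le hp b c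
    exact ⟨K, fun x hx => lipschitzWith_pruferField (hK x hx)⟩
  · obtain ⟨K, hK⟩ := exists_abs_one_add_le hp b c
    refine ⟨1 + K, fun x hx s => ?_⟩
    have hfield : cos s ^ 2 - p x * sin s ^ 2 = 1 - (1 + p x) * sin s ^ 2 := by
      rw [cos_sq']
      ring
    calc ‖cos s ^ 2 - p x * sin s ^ 2‖
        ≤ ‖(1 : ℝ)‖ + ‖(1 + p x) * sin s ^ 2‖ := by rw [hfield]; exact norm_sub_le _ _
      _ ≤ 1 + K * 1 := by
        rw [norm_one, norm_mul, norm_of_nonneg (sq_nonneg (sin s))]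
        gcongr
        · exact hK x hx
        · exact sin_sq_le_one s
      _ = ((1 + K : ℝ≥0) : ℝ) := by push_cast; ring

namespace IsPruferAngle

variable {p p₁ p₂ θ α β : ℝ → ℝ} {a c x : ℝ}

theorem continuous (hθ : IsPruferAngle p θ) : Continuous θ :=
  continuous_iff_continuousAt.2 fun x => (hθ x).continuousAt

theorem exists_monotone (hp : Continuous p₁) (hα : IsPruferAngle p₁ α)
    (hβ : IsPruferAngle p₂ β) (h : p₂ ≤ p₁) :
    ∃ M : ℝ → ℝ, Monotone fun x => (β x - α x) * exp (M x) := by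
  have hαc := hα.continuous
  have hβc := hβ.continuous
  let m : ℝ → ℝ := fun x => -(1 + p₁ x) * sin (β x + α x) * sinc (β x - α x)
  have hm : Continuous m := by
    have := continuous_sinc
    fun_prop
  refine ⟨_, monotone_mul_exp_neg_integral hm (fun x => (hβ x).fun_sub (hα x)) (fun x => ?_) 0⟩
  have hsinc : sinc (β x - α x) * (β x - α x) = sin (β x - α x) := by
    rcases eq_or_ne (β x - α x) 0 with h | h
    · simp [h]
    · rw [sinc_of_ne_zero h, div_mul_cancel₀ _ h]
  have hgap := mul_nonneg (sub_nonneg.2 (h x)) (sq_nonneg (sin (β x)))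
  have hm_mul : m x * (β x - α x) = -(1 + p₁ x) * (sin (β x) ^ 2 - sin (α x) ^ 2) := by
    rw [sin_sq_sub_sin_sq, ← hsinc]
    ring
  rw [hm_mul, cos_sq', cos_sq']
  linarith

theorem le_of_le (hp : Continuous p₁) (hα : IsPruferAngle p₁ α) (hβ : IsPruferAngle p₂ β)
    (h : p₂ ≤ p₁) (ha : α a ≤ β a) (hx : a ≤ x) : α x ≤ β x := by
  obtain ⟨M, hM⟩ := hα.exists_monotone hp hβ h
  have ha : 0 ≤ (β a - α a) * exp (M a) := mul_nonneg (sub_nonneg.2 ha) (exp_pos _).le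
  exact sub_nonneg.1 (nonneg_of_mul_nonneg_left (ha.trans (hM hx)) (exp_pos _))

theorem lt_of_lt (hp : Continuous p₁) (hα : IsPruferAngle p₁ α) (hβ : IsPruferAngle p₂ β)
    (h : p₂ ≤ p₁) (ha : α a < β a) (hx : a ≤ x) : α x < β x := by
  obtain ⟨M, hM⟩ := hα.exists_monotone hp hβ h
  have ha : 0 < (β a - α a) * exp (M a) := mul_pos (sub_pos.2 ha) (exp_pos _)
  exact sub_pos.1 (pos_of_mul_pos_left (ha.trans_le (hM hx)) (exp_pos _).le)

theorem eqOn_Ici (hp : Continuous p) (hα : IsPruferAngle p α) (hβ : IsPruferAngle p β)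
    (ha : α a = β a) : EqOn α β (Ici a) := fun _ hx =>
  (hα.le_of_le hp hβ le_rfl ha.le hx).antisymm (hβ.le_of_le hp hα le_rfl ha.ge hx)

theorem frequently_sin_ne_zero (hθ : IsPruferAngle p θ) (x : ℝ) :
    ∃ᶠ z in 𝓝 x, sin (θ z) ≠ 0 := by
  intro h
  simp only [not_not] at h
  have hcos : cos (θ x) * (cos (θ x) ^ 2 - p x * sin (θ x) ^ 2) = 0 :=
    (hθ x).sin.unique ((hasDerivAt_const x (0 : ℝ)).congr_of_eventuallyEq h)
  have hsin : sin (θ x) = 0 := h.self_of_nhds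
  have hsq := sin_sq_add_cos_sq (θ x)
  rw [hsin] at hcos hsq
  simp_all

theorem lt_of_forall_lt (hp : Continuous p₁) (hα : IsPruferAngle p₁ α) (hβ : IsPruferAngle p₂ β)
    (h : ∀ x, p₂ x < p₁ x) (ha : α a ≤ β a) (hx : a < x) : α x < β x := by
  have hle : ∀ z, a ≤ z → α z ≤ β z := fun z hz => hα.le_of_le hp hβ (fun x => (h x).le) ha hz
  by_contra! hge
  have heq : ∀ z ∈ Ioo a x, α z = β z := by
    intro z hz
    refine (hle z hz.1.le).antisymm (le_of_not_gt fun hlt => ?_)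
    exact hge.not_gt (hα.lt_of_lt hp hβ (fun x => (h x).le) hlt hz.2.le)
  obtain ⟨m, hm⟩ := exists_between hx
  obtain ⟨z, hsin, hz⟩ := ((hβ.frequently_sin_ne_zero m).and_eventually
    (Ioo_mem_nhds hm.1 hm.2)).exists
  have hder := (hα z).unique ((hβ z).congr_of_eventuallyEq
    (eventually_of_mem (Ioo_mem_nhds hz.1 hz.2) heq))
  rw [heq z hz] at hder
  have := mul_pos (sub_pos.2 (h z)) (sq_pos_of_ne_zero hsin)
  linarith

theorem lt_of_sin_eq_zero (hθ : IsPruferAngle p θ) (hc : sin c = 0) (ha : c ≤ θ a)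
    (hx : a < x) : c < θ x :=
  lt_of_hasDerivAt_of_barrier hθ ha
    (fun y _ hy => by simp [hy, hc, cos_sq_of_sin_eq_zero hc]) hx

theorem lt_of_cos_eq_zero (hθ : IsPruferAngle p θ) (hp : ∀ y, a ≤ y → 0 < p y)
    (hc : cos c = 0) (ha : θ a ≤ c) (hx : a < x) : θ x < c := by
  have hsin : sin c ^ 2 = 1 := by rw [sin_sq, hc]; norm_num
  have hbarrier := lt_of_hasDerivAt_of_barrier (fun x => (hθ x).fun_neg) (neg_le_neg ha)
    (fun y hy hyc => by
      rw [neg_inj.1 hyc, hc, hsin]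
      linarith [hp y hy]) hx
  exact neg_lt_neg_iff.1 hbarrier

theorem hasDerivAt_cot (hθ : IsPruferAngle p θ) (hx : sin (θ x) ≠ 0) :
    HasDerivAt (fun x => cot (θ x)) (p x - cot (θ x) ^ 2) x := by
  simp only [cot_eq_cos_div_sin]
  refine ((hθ x).cos.fun_div (hθ x).sin hx).congr_deriv ?_
  field_simp
  linear_combination (p x * sin (θ x) ^ 2 - cos (θ x) ^ 2) * sin_sq_add_cos_sq (θ x)

theorem not_forall_mem_decaying_sector (hα : IsPruferAngle p₁ α) (hβ : IsPruferAngle p₂ β)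
    (h : p₂ ≤ p₁) (hc : sin c = 0) (X : ℝ) :
    ¬ ∀ x, X ≤ x → c - π / 2 ≤ α x ∧ α x < β x ∧ β x < c := by
  intro hsector
  have hmem : ∀ x, X ≤ x → α x ∈ Ioo (c - π) c ∧ β x ∈ Ioo (c - π) c := fun x hx => by
    obtain ⟨hα, hαβ, hβ⟩ := hsector x hx
    exact ⟨⟨by linarith [pi_pos], hαβ.trans hβ⟩, ⟨by linarith [pi_pos], hβ⟩⟩
  have hsinα : ∀ x, X ≤ x → sin (α x) ≠ 0 := fun x hx =>
    left_ne_zero_of_mul (sin_mul_sin_pos hc (hmem x hx).1 (hmem x hx).2).ne'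
  have hsinβ : ∀ x, X ≤ x → sin (β x) ≠ 0 := fun x hx =>
    right_ne_zero_of_mul (sin_mul_sin_pos hc (hmem x hx).1 (hmem x hx).2).ne'
  have hcotα : ∀ x, X ≤ x → cot (α x) ≤ 0 := fun x hx => by
    rw [cot_eq_cos_div_sin, ← mul_div_mul_left _ _ (hsinα x hx), ← sq]
    exact div_nonpos_of_nonpos_of_nonneg (sin_mul_cos_nonpos hc
      ⟨(hsector x hx).1, (hmem x hx).1.2.le⟩) (sq_nonneg _)
  have hpos : ∀ x, X ≤ x → 0 < cot (α x) - cot (β x) := fun x hx => by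
    obtain ⟨hαx, hαβ, hβx⟩ := hsector x hx
    rw [cot_sub_cot (hsinα x hx) (hsinβ x hx)]
    exact div_pos (sin_pos_of_pos_of_lt_pi (sub_pos.2 hαβ) (by linarith [pi_pos]))
      (sin_mul_sin_pos hc (hmem x hx).1 (hmem x hx).2)
  refine not_forall_sq_le_deriv hpos (fun x hx =>
    (hα.hasDerivAt_cot (hsinα x hx)).fun_sub (hβ.hasDerivAt_cot (hsinβ x hx))) fun x hx => ?_
  nlinarith [h x, hpos x hx, hcotα x hx]

end IsPruferAngle

/-- The angle `θ` ends in the quadrant `[c - π / 2, c)`. For `sin c = 0` the function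
`A sin θ` and its derivative `A cos θ` then have opposite signs. -/
def Decays (θ : ℝ → ℝ) (c : ℝ) : Prop :=
  ∀ᶠ x in atTop, θ x ∈ Ico (c - π / 2) c

/-- The angle `θ` ends in the quadrant `(c, c + π / 2]`. For `sin c = 0` the function
`A sin θ` and its derivative `A cos θ` then have the same sign. -/
def Grows (θ : ℝ → ℝ) (c : ℝ) : Prop :=
  ∀ᶠ x in atTop, θ x ∈ Ioc c (c + π / 2)

theorem Decays.exists_ge_of_lt {p₁ p₂ α β : ℝ → ℝ} {a c : ℝ} (hd : Decays α c)
    (hp : Continuous p₁) (hα : IsPruferAngle p₁ α) (hβ : IsPruferAngle p₂ β) (h : p₂ ≤ p₁)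
    (hc : sin c = 0) (ha : α a < β a) : ∃ x, a ≤ x ∧ c ≤ β x := by
  by_contra! hlt
  obtain ⟨X, hX⟩ := eventually_atTop.1 hd
  refine hα.not_forall_mem_decaying_sector hβ h hc (max X a) fun x hx => ?_
  have hax : a ≤ x := (le_max_right X a).trans hx
  exact ⟨(hX x ((le_max_left X a).trans hx)).1, hα.lt_of_lt hp hβ h ha hax, hlt x hax⟩

theorem cos_add_pi_div_two_of_sin_eq_zero {c : ℝ} (hc : sin c = 0) : cos (c + π / 2) = 0 := by
  rw [cos_add_pi_div_two, hc, neg_zero]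

theorem IsPruferAngle.grows {p θ : ℝ → ℝ} {c X : ℝ} (hθ : IsPruferAngle p θ)
    (hp : ∀ x, X ≤ x → 0 < p x) (hc : sin c = 0) (hX : θ X ∈ Icc c (c + π / 2)) : Grows θ c :=
  (eventually_gt_atTop X).mono fun _ hx => ⟨hθ.lt_of_sin_eq_zero hc hX.1 hx,
    (hθ.lt_of_cos_eq_zero hp (cos_add_pi_div_two_of_sin_eq_zero hc) hX.2 hx).le⟩

theorem IsPruferAngle.exists_decays_or_grows {p θ : ℝ → ℝ} (hθ : IsPruferAngle p θ)
    (hp : ∀ᶠ x in atTop, 0 < p x) : ∃ c, sin c = 0 ∧ (Decays θ c ∨ Grows θ c) := by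
  obtain ⟨X, hX⟩ := eventually_atTop.1 hp
  set c : ℝ := ⌊θ X / π⌋ * π
  have hc : sin c = 0 := sin_int_mul_pi _
  have hc' : sin (c + π) = 0 := by rw [sin_add_pi, hc, neg_zero]
  have hcX : c ≤ θ X := (le_div_iff₀ pi_pos).1 (Int.floor_le _)
  have hXc : θ X < c + π := by
    simpa only [add_one_mul] using (div_lt_iff₀ pi_pos).1 (Int.lt_floor_add_one (θ X / π))
  have hc_le : ∀ x, X ≤ x → c ≤ θ x := fun x hx => by
    rcases hx.eq_or_lt with rfl | hx
    · exact hcX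
    · exact (hθ.lt_of_sin_eq_zero hc hcX hx).le
  by_cases hlow : ∃ y, X ≤ y ∧ θ y ≤ c + π / 2
  · obtain ⟨y, hXy, hy⟩ := hlow
    exact ⟨c, hc, .inr (hθ.grows (fun x hx => hX x (hXy.trans hx)) hc ⟨hc_le y hXy, hy⟩)⟩
  by_cases hhigh : ∃ y, X ≤ y ∧ c + π ≤ θ y
  · obtain ⟨y, hXy, hy⟩ := hhigh
    obtain ⟨z, hz, hzc⟩ := intermediate_value_Icc hXy hθ.continuous.continuousOn ⟨hXc.le, hy⟩
    exact ⟨c + π, hc', .inr (hθ.grows (fun x hx => hX x (hz.1.trans hx)) hc'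
      ⟨hzc.ge, by linarith [pi_pos]⟩)⟩
  push Not at hlow hhigh
  exact ⟨c + π, hc', .inl ((eventually_ge_atTop X).mono fun x hx =>
    ⟨by linarith [hlow x hx], hhigh x hx⟩)⟩

/-- The Prüfer angle of `φ'' = (q - lam) φ` that vanishes at `a`, hence belongs to the solution
with a Dirichlet condition at `a`. It exists for continuous `q` and is arbitrary otherwise. -/
def shootingAngle (q : ℝ → ℝ) (a lam : ℝ) : ℝ → ℝ :=
  Classical.epsilon fun θ => θ a = 0 ∧ IsPruferAngle (fun x => q x - lam) θ

/-- The spectral parameters for which the Dirichlet solution on `[a, ∞)` has at least `i + 1`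
zeros in `(a, ∞)`. -/
def crossing (q : ℝ → ℝ) (a : ℝ) (i : ℕ) : Set ℝ :=
  {lam | ∃ x, a ≤ x ∧ (i + 1) * π ≤ shootingAngle q a lam x}

/-- The Dirichlet eigenvalue number `i`, counted from `0`, of `-d²/dx² + q` on `(a, ∞)`. -/
def level (q : ℝ → ℝ) (a : ℝ) (i : ℕ) : ℝ := sInf (crossing q a i)

theorem sin_succ_mul_pi (i : ℕ) : sin ((i + 1) * π) = 0 := by
  exact_mod_cast sin_nat_mul_pi (i + 1)

theorem pi_le_succ_mul_pi (i : ℕ) : π ≤ (i + 1) * π :=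
  le_mul_of_one_le_left pi_pos.le (by linarith [i.cast_nonneg (α := ℝ)])

section Shooting

variable {q : ℝ → ℝ} {a x lam lam₁ lam₂ : ℝ} {i : ℕ}

theorem shootingAngle_spec (hq : Continuous q) (a lam : ℝ) :
    shootingAngle q a lam a = 0 ∧
      IsPruferAngle (fun x => q x - lam) (shootingAngle q a lam) :=
  Classical.epsilon_spec (exists_isPruferAngle (hq.sub continuous_const) a 0)

theorem shootingAngle_self (hq : Continuous q) (a lam : ℝ) : shootingAngle q a lam a = 0 :=
  (shootingAngle_spec hq a lam).1

theorem isPruferAngle_shootingAngle (hq : Continuous q) (a lam : ℝ) :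
    IsPruferAngle (fun x => q x - lam) (shootingAngle q a lam) :=
  (shootingAngle_spec hq a lam).2

theorem shootingAngle_pos (hq : Continuous q) (hx : a < x) : 0 < shootingAngle q a lam x :=
  (isPruferAngle_shootingAngle hq a lam).lt_of_sin_eq_zero sin_zero
    (shootingAngle_self hq a lam).ge hx

theorem shootingAngle_mono (hq : Continuous q) (h : lam₁ ≤ lam₂) (hx : a ≤ x) :
    shootingAngle q a lam₁ x ≤ shootingAngle q a lam₂ x :=
  (isPruferAngle_shootingAngle hq a lam₁).le_of_le (hq.sub continuous_const)
    (isPruferAngle_shootingAngle hq a lam₂) (fun _ => sub_le_sub_left h _)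
    (by rw [shootingAngle_self hq, shootingAngle_self hq]) hx

theorem shootingAngle_strictMono (hq : Continuous q) (h : lam₁ < lam₂) (hx : a < x) :
    shootingAngle q a lam₁ x < shootingAngle q a lam₂ x :=
  (isPruferAngle_shootingAngle hq a lam₁).lt_of_forall_lt (hq.sub continuous_const)
    (isPruferAngle_shootingAngle hq a lam₂) (fun _ => sub_lt_sub_left h _)
    (by rw [shootingAngle_self hq, shootingAngle_self hq]) hx

theorem continuous_shootingAngle (hq : Continuous q) (hx : a ≤ x) :
    Continuous fun lam => shootingAngle q a lam x := by
  refine continuous_iff_continuousAt.2 fun lam => ?_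
  obtain ⟨K, hK⟩ := exists_abs_one_add_le (hq.sub continuous_const) (b := a) (c := x)
    (p := fun t => q t - lam)
  have hgronwall : ∀ l, dist (shootingAngle q a l x) (shootingAngle q a lam x) ≤
      gronwallBound 0 K (|l - lam| + 0) (x - a) := by
    intro l
    have hl := isPruferAngle_shootingAngle hq a l
    have hlam := isPruferAngle_shootingAngle hq a lam
    refine dist_le_of_approx_trajectories_ODE_of_mem (K := K) (a := a) (b := x)
      (v := fun t s : ℝ => cos s ^ 2 - (q t - lam) * sin s ^ 2) (s := fun _ => univ)
      (fun t ht => (lipschitzWith_pruferField (hK t (Ico_subset_Icc_self ht))).lipschitzOnWith)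
      hl.continuous.continuousOn (fun t _ => (hl t).hasDerivWithinAt) (fun t _ => ?_)
      (fun _ _ => trivial) hlam.continuous.continuousOn (fun t _ => (hlam t).hasDerivWithinAt)
      (fun t _ => (dist_self _).le) (fun _ _ => trivial)
      (by rw [shootingAngle_self hq, shootingAngle_self hq, dist_self]) x ⟨hx, le_rfl⟩
    have hdiff : cos (shootingAngle q a l t) ^ 2 - (q t - l) * sin (shootingAngle q a l t) ^ 2
        - (cos (shootingAngle q a l t) ^ 2 - (q t - lam) * sin (shootingAngle q a l t) ^ 2)
        = (l - lam) * sin (shootingAngle q a l t) ^ 2 := by ring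
    rw [dist_eq, hdiff, abs_mul, abs_of_nonneg (sq_nonneg (sin _))]
    exact mul_le_of_le_one_right (abs_nonneg _) (sin_sq_le_one _)
  have hbound : Tendsto (fun l => gronwallBound 0 K (|l - lam| + 0) (x - a)) (𝓝 lam) (𝓝 0) := by
    have hcont : Continuous fun l => gronwallBound 0 K (|l - lam| + 0) (x - a) :=
      (gronwallBound_continuous_ε _ _ _).comp (by fun_prop)
    simpa [gronwallBound_ε0_δ0] using hcont.tendsto lam
  exact tendsto_iff_dist_tendsto_zero.2 (squeeze_zero (fun _ => dist_nonneg) hgronwall hbound)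

theorem lt_shootingAngle_of_le (hq : Continuous q) {y : ℝ}
    (hx : (i + 1) * π ≤ shootingAngle q a lam x) (hxy : x < y) :
    (i + 1) * π < shootingAngle q a lam y :=
  (isPruferAngle_shootingAngle hq a lam).lt_of_sin_eq_zero (sin_succ_mul_pi i) hx hxy

theorem eventually_lt_of_mem_crossing (hq : Continuous q) (h : lam ∈ crossing q a i) :
    ∀ᶠ x in atTop, (i + 1) * π < shootingAngle q a lam x := by
  obtain ⟨x, -, hx⟩ := h
  exact (eventually_gt_atTop x).mono fun y => lt_shootingAngle_of_le hq hx

theorem isUpperSet_crossing (hq : Continuous q) (a : ℝ) (i : ℕ) :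
    IsUpperSet (crossing q a i) := by
  rintro lam₁ lam₂ h ⟨x, hax, hx⟩
  exact ⟨x, hax, hx.trans (shootingAngle_mono hq h hax)⟩

theorem isOpen_crossing (hq : Continuous q) (a : ℝ) (i : ℕ) : IsOpen (crossing q a i) := by
  rw [isOpen_iff_mem_nhds]
  intro lam h
  obtain ⟨x, hx, hax⟩ := ((eventually_lt_of_mem_crossing hq h).and (eventually_ge_atTop a)).exists
  filter_upwards [(continuous_shootingAngle hq hax).continuousAt.eventually_const_lt hx] with l hl
  exact ⟨x, hax, hl.le⟩

theorem crossing_nonempty (hq : Continuous q) (a : ℝ) (i : ℕ) : (crossing q a i).Nonempty := by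
  set N : ℝ := (i + 1) * π
  have hN0 : 0 ≤ N := pi_pos.le.trans (pi_le_succ_mul_pi i)
  obtain ⟨K, hK⟩ := exists_abs_one_add_le hq a (a + N)
  have hθ := isPruferAngle_shootingAngle hq a K
  have hderiv : ∀ x ∈ Icc a (a + N), 1 ≤ deriv (shootingAngle q a K) x := fun x hx => by
    rw [(hθ x).deriv, cos_sq']
    nlinarith [(le_abs_self _).trans (hK x hx), sq_nonneg (sin (shootingAngle q a K x))]
  have hgrowth := (convex_Icc a (a + N)).mul_sub_le_image_sub_of_le_deriv
    hθ.continuous.continuousOn (fun x _ => (hθ x).differentiableAt.differentiableWithinAt)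
    (fun x hx => hderiv x (interior_subset hx)) a ⟨le_rfl, by linarith⟩ (a + N)
    ⟨by linarith, le_rfl⟩ (by linarith)
  rw [shootingAngle_self hq] at hgrowth
  exact ⟨K, a + N, by linarith, by linarith⟩

theorem exists_forall_lt_of_tendsto_atTop (hq : Continuous q) (hlim : Tendsto q atTop atTop)
    (a : ℝ) : ∃ m, ∀ x, a ≤ x → m < q x := by
  obtain ⟨X, hX⟩ := eventually_atTop.1 (hlim.eventually_gt_atTop 0)
  obtain ⟨m, hm⟩ := (isCompact_Icc (a := a) (b := X)).bddBelow_image hq.continuousOn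
  refine ⟨min 0 (m - 1), fun x hax => ?_⟩
  rcases le_total X x with hx | hx
  · exact (min_le_left _ _).trans_lt (hX x hx)
  · have := hm (mem_image_of_mem q ⟨hax, hx⟩)
    exact (min_le_right _ _).trans_lt (by linarith)

theorem crossing_bddBelow (hq : Continuous q) (hlim : Tendsto q atTop atTop) (a : ℝ) (i : ℕ) :
    BddBelow (crossing q a i) := by
  obtain ⟨m, hm⟩ := exists_forall_lt_of_tendsto_atTop hq hlim a
  refine ⟨m, fun lam h => ?_⟩
  by_contra! hlam
  obtain ⟨x, hx, hax⟩ := ((eventually_lt_of_mem_crossing hq h).and (eventually_gt_atTop a)).exists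
  have hlt : shootingAngle q a lam x < π / 2 :=
    (isPruferAngle_shootingAngle hq a lam).lt_of_cos_eq_zero
      (fun y hy => by linarith [hm y hy]) cos_pi_div_two
      (by linarith [shootingAngle_self hq a lam, pi_pos]) hax
  linarith [pi_le_succ_mul_pi i, pi_pos]

theorem crossing_eq_Ioi_level (hq : Continuous q) (hlim : Tendsto q atTop atTop) (a : ℝ) (i : ℕ) :
    crossing q a i = Ioi (level q a i) := by
  have hne := crossing_nonempty hq a i
  refine Subset.antisymm (fun lam h => ?_) fun lam h => ?_
  · obtain ⟨l, hlt, hl⟩ := ((eventually_mem_nhdsWithin (a := lam) (s := Iio lam)).and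
      (nhdsWithin_le_nhds ((isOpen_crossing hq a i).mem_nhds h))).exists
    exact (csInf_le (crossing_bddBelow hq hlim a i) hl).trans_lt hlt
  · obtain ⟨l, hl, hlt⟩ := exists_lt_of_csInf_lt hne h
    exact isUpperSet_crossing hq a i hlt.le hl

theorem mem_crossing_iff (hq : Continuous q) (hlim : Tendsto q atTop atTop) :
    lam ∈ crossing q a i ↔ level q a i < lam := by
  rw [crossing_eq_Ioi_level hq hlim, mem_Ioi]

theorem shootingAngle_level_lt (hq : Continuous q) (hlim : Tendsto q atTop atTop) (hx : a ≤ x) :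
    shootingAngle q a (level q a i) x < (i + 1) * π :=
  lt_of_not_ge fun h => lt_irrefl _ ((mem_crossing_iff hq hlim).1 ⟨x, hx, h⟩)

theorem level_decays (hq : Continuous q) (hlim : Tendsto q atTop atTop) (a : ℝ) (i : ℕ) :
    Decays (shootingAngle q a (level q a i)) ((i + 1) * π) := by
  obtain ⟨X, hX⟩ := eventually_atTop.1 (hlim.eventually_gt_atTop (level q a i + 1))
  filter_upwards [eventually_ge_atTop X, eventually_ge_atTop a] with x hXx hax
  refine ⟨le_of_not_gt fun hlow => ?_, shootingAngle_level_lt hq hlim hax⟩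
  have hcont := (continuous_shootingAngle hq hax).continuousAt (x := level q a i)
  have hnear : ∀ᶠ lam in 𝓝[>] level q a i,
      shootingAngle q a lam x < (i + 1) * π - π / 2 :=
    nhdsWithin_le_nhds (hcont.eventually_lt_const hlow)
  obtain ⟨lam, hlam, hlevel, hlevel'⟩ :=
    (hnear.and (Ioo_mem_nhdsGT (lt_add_one (level q a i)))).exists
  obtain ⟨y, hy, hxy⟩ := ((eventually_lt_of_mem_crossing hq
    ((mem_crossing_iff hq hlim).2 hlevel)).and (eventually_gt_atTop x)).exists
  have hlt := (isPruferAngle_shootingAngle hq a lam).lt_of_cos_eq_zero (a := x)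
    (fun z hz => by linarith [hX z (hXx.trans hz)])
    (by rw [cos_sub_pi_div_two, sin_succ_mul_pi]) hlam.le hxy
  linarith [pi_pos]

theorem decays_iff_eq_level (hq : Continuous q) (hlim : Tendsto q atTop atTop) :
    Decays (shootingAngle q a lam) ((i + 1) * π) ↔ lam = level q a i := by
  refine ⟨fun h => le_antisymm ?_ ?_, fun h => h ▸ level_decays hq hlim a i⟩
  · refine le_of_not_gt fun hlt => ?_
    obtain ⟨x, hx, hx'⟩ := ((eventually_lt_of_mem_crossing hq
      ((mem_crossing_iff hq hlim).2 hlt)).and h).exists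
    exact hx.not_gt hx'.2
  · refine le_of_forall_gt_imp_ge_of_dense fun l hl => ?_
    obtain ⟨x, hx, hxi⟩ := h.exists_ge_of_lt (hq.sub continuous_const)
      (isPruferAngle_shootingAngle hq a lam) (isPruferAngle_shootingAngle hq a l)
      (fun _ => sub_le_sub_left hl.le _) (sin_succ_mul_pi i)
      (shootingAngle_strictMono hq hl (lt_add_one a))
    exact ((mem_crossing_iff hq hlim).1 ⟨x, (lt_add_one a).le.trans hx, hxi⟩).le

theorem level_strictMono (hq : Continuous q) (hlim : Tendsto q atTop atTop) (a : ℝ) :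
    StrictMono (level q a) := by
  refine strictMono_nat_of_lt_succ fun i => (mem_crossing_iff hq hlim).1 ?_
  obtain ⟨x, hx, hax⟩ := ((level_decays hq hlim a (i + 1)).and (eventually_ge_atTop a)).exists
  refine ⟨x, hax, le_trans ?_ hx.1⟩
  push_cast
  linarith [pi_pos]

theorem level_lt_level_of_lt (hq : Continuous q) (hlim : Tendsto q atTop atTop) {b : ℝ}
    (h : a < b) (i : ℕ) : level q a i < level q b i := by
  obtain ⟨x, hx, hxi⟩ := (level_decays hq hlim b i).exists_ge_of_lt (hq.sub continuous_const)
    (isPruferAngle_shootingAngle hq b _) (isPruferAngle_shootingAngle hq a (level q b i)) le_rfl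
    (sin_succ_mul_pi i) (by rw [shootingAngle_self hq b]; exact shootingAngle_pos hq h)
  exact (mem_crossing_iff hq hlim).1 ⟨x, h.le.trans hx, hxi⟩

theorem shootingAngle_comp_sub (hq : Continuous q) (k : ℝ) (hx : a ≤ x) :
    shootingAngle (fun x => q (x - k)) a lam x = shootingAngle q (a - k) lam (x - k) := by
  have hqk : Continuous fun x => q (x - k) := by fun_prop
  refine (isPruferAngle_shootingAngle hqk a lam).eqOn_Ici
    (β := fun x => shootingAngle q (a - k) lam (x - k)) (hqk.sub continuous_const)
    (fun x => ?_) ?_ hx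
  · exact (isPruferAngle_shootingAngle hq (a - k) lam (x - k)).comp_sub_const x k
  · rw [shootingAngle_self hqk, shootingAngle_self hq]

theorem level_comp_sub (hq : Continuous q) (a k : ℝ) (i : ℕ) :
    level (fun x => q (x - k)) a i = level q (a - k) i := by
  have hcrossing : crossing (fun x => q (x - k)) a i = crossing q (a - k) i := by
    ext lam
    constructor
    · rintro ⟨x, hax, hx⟩
      exact ⟨x - k, sub_le_sub_right hax k, shootingAngle_comp_sub hq k hax ▸ hx⟩
    · rintro ⟨x, hax, hx⟩
      refine ⟨x + k, sub_le_iff_le_add.1 hax, ?_⟩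
      rwa [shootingAngle_comp_sub hq k (sub_le_iff_le_add.1 hax), add_sub_cancel_right]
  rw [level, hcrossing, level]

theorem shootingAngle_decays_or_grows (hq : Continuous q) (hlim : Tendsto q atTop atTop)
    (a lam : ℝ) : lam ∈ range (level q a) ∨ ∃ c, sin c = 0 ∧ Grows (shootingAngle q a lam) c := by
  obtain ⟨c, hc, h⟩ := (isPruferAngle_shootingAngle hq a lam).exists_decays_or_grows
    ((hlim.eventually_gt_atTop lam).mono fun x hx => sub_pos.2 hx)
  refine h.imp (fun hd => ?_) fun hg => ⟨c, hc, hg⟩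
  obtain ⟨x, hx, hax⟩ := (hd.and (eventually_gt_atTop a)).exists
  have hc0 : 0 < c := (shootingAngle_pos hq hax).trans hx.2
  obtain ⟨j, rfl⟩ := sin_eq_zero_iff.1 hc
  obtain ⟨i, rfl⟩ := Int.eq_succ_of_zero_lt
    (Int.cast_pos.1 (pos_of_mul_pos_left hc0 pi_pos.le))
  refine ⟨i, ((decays_iff_eq_level hq hlim).1 ?_).symm⟩
  simpa using hd

end Shooting

section LinearEquation

variable {E : Type*} [NormedAddCommGroup E] [NormedSpace ℝ E]

/-- `u` solves `u'' = p u` on `[a, ∞)` with `u' = v`; derivatives at `a` are one-sided. -/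
structure IsSolution (p : ℝ → ℝ) (a : ℝ) (u v : ℝ → E) : Prop where
  hasDerivWithinAt_fst : ∀ x ∈ Ici a, HasDerivWithinAt u (v x) (Ici a) x
  hasDerivWithinAt_snd : ∀ x ∈ Ici a, HasDerivWithinAt v (p x • u x) (Ici a) x

/-- The factor `A` with `A a = 1` for which `φ = A sin θ` and `φ' = A cos θ` solve `φ'' = p φ`
when `θ` is a Prüfer angle. -/
def amplitude (p : ℝ → ℝ) (a : ℝ) (θ : ℝ → ℝ) (x : ℝ) : ℝ :=
  exp (∫ t in a..x, (1 + p t) * (sin (θ t) * cos (θ t)))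

variable {p θ : ℝ → ℝ} {u v u₁ u₂ v₁ v₂ : ℝ → E} {a x : ℝ}

namespace IsSolution

theorem continuousOn_fst (h : IsSolution p a u v) : ContinuousOn u (Ici a) :=
  fun x hx => (h.hasDerivWithinAt_fst x hx).continuousWithinAt

theorem continuousOn_snd (h : IsSolution p a u v) : ContinuousOn v (Ici a) :=
  fun x hx => (h.hasDerivWithinAt_snd x hx).continuousWithinAt

theorem sub (h₁ : IsSolution p a u₁ v₁) (h₂ : IsSolution p a u₂ v₂) :
    IsSolution p a (fun x => u₁ x - u₂ x) fun x => v₁ x - v₂ x where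
  hasDerivWithinAt_fst x hx := (h₁.hasDerivWithinAt_fst x hx).fun_sub (h₂.hasDerivWithinAt_fst x hx)
  hasDerivWithinAt_snd x hx :=
    ((h₁.hasDerivWithinAt_snd x hx).fun_sub (h₂.hasDerivWithinAt_snd x hx)).congr_deriv
      (smul_sub _ _ _).symm

theorem smul_const {φ ψ : ℝ → ℝ} (h : IsSolution p a φ ψ) (r : E) :
    IsSolution p a (fun x => φ x • r) fun x => ψ x • r where
  hasDerivWithinAt_fst x hx := (h.hasDerivWithinAt_fst x hx).smul_const r
  hasDerivWithinAt_snd x hx :=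
    ((h.hasDerivWithinAt_snd x hx).smul_const r).congr_deriv (smul_assoc _ _ _)

theorem eqOn_zero (hp : Continuous p) (h : IsSolution p a u v) (hu : u a = 0) (hv : v a = 0) :
    EqOn u 0 (Ici a) := by
  intro b hb
  obtain ⟨C, hC⟩ := (isCompact_Icc (a := a) (b := b)).exists_bound_of_continuousOn hp.continuousOn
  have hbound : ∀ t ∈ Ico a b, ‖(v t, p t • u t)‖ ≤ max 1 C * ‖(u t, v t)‖ := by
    intro t ht
    rw [Prod.norm_def, Prod.norm_def]
    refine max_le ?_ ?_
    · calc ‖v t‖ ≤ 1 * max ‖u t‖ ‖v t‖ := by rw [one_mul]; exact le_max_right _ _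
        _ ≤ max 1 C * max ‖u t‖ ‖v t‖ := by gcongr; exact le_max_left _ _
    · rw [norm_smul]
      gcongr
      · exact (hC t (Ico_subset_Icc_self ht)).trans (le_max_right _ _)
      · exact le_max_left _ _
  have hzero := eq_zero_of_abs_deriv_le_mul_abs_self_of_eq_zero_right (f := fun t => (u t, v t))
    ((h.continuousOn_fst.prodMk h.continuousOn_snd).mono Icc_subset_Ici_self)
    (fun t ht => ((h.hasDerivWithinAt_fst t ht.1).prodMk (h.hasDerivWithinAt_snd t ht.1)).mono
      (Ici_subset_Ici.2 ht.1)) (by rw [hu, hv]; rfl) hbound b ⟨hb, le_rfl⟩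
  exact (Prod.mk.inj hzero).1

theorem eqOn (hp : Continuous p) (h₁ : IsSolution p a u₁ v₁) (h₂ : IsSolution p a u₂ v₂)
    (hu : u₁ a = u₂ a) (hv : v₁ a = v₂ a) : EqOn u₁ u₂ (Ici a) := fun _ hx =>
  sub_eq_zero.1 ((h₁.sub h₂).eqOn_zero hp (sub_eq_zero.2 hu) (sub_eq_zero.2 hv) hx)

end IsSolution

theorem amplitude_self (p : ℝ → ℝ) (a : ℝ) (θ : ℝ → ℝ) : amplitude p a θ a = 1 := by
  simp [amplitude]

theorem amplitude_pos : 0 < amplitude p a θ x := exp_pos _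

namespace IsPruferAngle

theorem hasDerivAt_amplitude (hp : Continuous p) (hθ : IsPruferAngle p θ) (a x : ℝ) :
    HasDerivAt (amplitude p a θ)
      (amplitude p a θ x * ((1 + p x) * (sin (θ x) * cos (θ x)))) x := by
  have hθc := hθ.continuous
  exact (hasDerivAt_integral_of_continuous (by fun_prop) a x).exp

theorem hasDerivAt_amplitude_mul_sin (hp : Continuous p) (hθ : IsPruferAngle p θ) (a x : ℝ) :
    HasDerivAt (fun x => amplitude p a θ x * sin (θ x)) (amplitude p a θ x * cos (θ x)) x := by
  refine ((hθ.hasDerivAt_amplitude hp a x).fun_mul (hθ x).sin).congr_deriv ?_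
  linear_combination amplitude p a θ x * cos (θ x) * sin_sq_add_cos_sq (θ x)

theorem hasDerivAt_amplitude_mul_cos (hp : Continuous p) (hθ : IsPruferAngle p θ) (a x : ℝ) :
    HasDerivAt (fun x => amplitude p a θ x * cos (θ x))
      (p x * (amplitude p a θ x * sin (θ x))) x := by
  refine ((hθ.hasDerivAt_amplitude hp a x).fun_mul (hθ x).cos).congr_deriv ?_
  linear_combination amplitude p a θ x * p x * sin (θ x) * sin_sq_add_cos_sq (θ x)

theorem isSolution (hp : Continuous p) (hθ : IsPruferAngle p θ) (a : ℝ) :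
    IsSolution p a (fun x => amplitude p a θ x * sin (θ x))
      fun x => amplitude p a θ x * cos (θ x) where
  hasDerivWithinAt_fst x _ := (hθ.hasDerivAt_amplitude_mul_sin hp a x).hasDerivWithinAt
  hasDerivWithinAt_snd x _ := (hθ.hasDerivAt_amplitude_mul_cos hp a x).hasDerivWithinAt

theorem eq_amplitude_smul (hp : Continuous p) (hθ : IsPruferAngle p θ) (h : IsSolution p a u v)
    {r : E} (hu : u a = sin (θ a) • r) (hv : v a = cos (θ a) • r) (hx : a ≤ x) :
    u x = (amplitude p a θ x * sin (θ x)) • r :=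
  h.eqOn hp ((hθ.isSolution hp a).smul_const r) (by simp [amplitude_self, hu])
    (by simp [amplitude_self, hv]) hx

theorem continuous_amplitude_mul_sin (hp : Continuous p) (hθ : IsPruferAngle p θ) (a : ℝ) :
    Continuous fun x => amplitude p a θ x * sin (θ x) :=
  continuous_iff_continuousAt.2 fun x => (hθ.hasDerivAt_amplitude_mul_sin hp a x).continuousAt

theorem not_integrableOn_sq_of_grows (hp : Continuous p) (hθ : IsPruferAngle p θ) {c : ℝ}
    (hc : sin c = 0) (h : Grows θ c) (a : ℝ) :
    ¬ IntegrableOn (fun x => (amplitude p a θ x * sin (θ x)) ^ 2) (Ioi a) := by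
  obtain ⟨X, hX⟩ := eventually_atTop.1 (h.and (eventually_ge_atTop a))
  have hderiv := fun x => (hθ.hasDerivAt_amplitude_mul_sin hp a x).fun_pow 2
  have hmono : MonotoneOn (fun x => (amplitude p a θ x * sin (θ x)) ^ 2) (Ici X) := by
    refine monotoneOn_of_hasDerivWithinAt_nonneg (convex_Ici X)
      (fun x _ => (hderiv x).continuousAt.continuousWithinAt)
      (fun x _ => (hderiv x).hasDerivWithinAt) fun x hx => ?_
    have hsc := sin_mul_cos_nonneg hc (Ioc_subset_Icc_self (hX x (interior_subset hx)).1)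
    have := mul_nonneg (sq_nonneg (amplitude p a θ x)) hsc
    norm_num
    linarith
  have hsin : sin (θ X) ≠ 0 := by
    obtain ⟨⟨hcX, hXc⟩, -⟩ := hX X le_rfl
    rw [← add_sub_cancel c (θ X), sin_add, hc, zero_mul, zero_add]
    exact mul_ne_zero (pow_ne_zero_iff two_ne_zero |>.1
      (cos_sq_of_sin_eq_zero hc ▸ one_ne_zero)) (sin_pos_of_pos_of_lt_pi (sub_pos.2 hcX)
      (by linarith [pi_pos])).ne'
  exact fun h_int => not_integrableOn_Ioi_of_monotoneOn hmono
    (sq_pos_of_ne_zero (mul_ne_zero amplitude_pos.ne' hsin))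
    (h_int.mono_set (Ioi_subset_Ioi (hX X le_rfl).2))

theorem integrableOn_sq_of_decays (hp : Continuous p) (hp1 : ∀ᶠ x in atTop, 1 ≤ p x)
    (hθ : IsPruferAngle p θ) {c : ℝ} (hc : sin c = 0) (h : Decays θ c) (a : ℝ) :
    IntegrableOn (fun x => (amplitude p a θ x * sin (θ x)) ^ 2) (Ioi a) := by
  obtain ⟨X, hX⟩ := eventually_atTop.1 (h.and (hp1.and (eventually_ge_atTop a)))
  have hcont := (hθ.continuous_amplitude_mul_sin hp a).pow 2
  have htail : IntegrableOn (fun x => (amplitude p a θ x * sin (θ x)) ^ 2) (Ioi X) := by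
    refine integrableOn_Ioi_of_le_deriv (B := 0) hcont
      (fun x _ => (hθ.hasDerivAt_amplitude_mul_sin hp a x).fun_mul
        (hθ.hasDerivAt_amplitude_mul_cos hp a x)) (fun x _ => sq_nonneg _)
      (fun x hx => ?_) fun x hx => ?_
    · have hpx := mul_nonneg (sub_nonneg.2 (hX x hx).2.1)
        (sq_nonneg (amplitude p a θ x * sin (θ x)))
      nlinarith [sq_nonneg (amplitude p a θ x * cos (θ x))]
    · have hsc := sin_mul_cos_nonpos hc (Ico_subset_Icc_self (hX x hx).1)
      have := mul_nonpos_of_nonneg_of_nonpos (sq_nonneg (amplitude p a θ x)) hsc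
      linarith
  rw [← Ioc_union_Ioi_eq_Ioi (hX X le_rfl).2.2]
  exact (hcont.integrableOn_Icc.mono_set Ioc_subset_Icc_self).union htail

end IsPruferAngle

end LinearEquation

/-- The solution of `-φ'' + q φ = lam φ` with `φ a = 0` and `φ' a = 1`. -/
def dirichletSol (q : ℝ → ℝ) (a lam x : ℝ) : ℝ :=
  amplitude (fun x => q x - lam) a (shootingAngle q a lam) x * sin (shootingAngle q a lam x)

section DirichletSol

variable {q : ℝ → ℝ} {a lam : ℝ}

theorem continuous_dirichletSol (hq : Continuous q) (a lam : ℝ) :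
    Continuous (dirichletSol q a lam) :=
  (isPruferAngle_shootingAngle hq a lam).continuous_amplitude_mul_sin (hq.sub continuous_const) a

theorem dirichletSol_self (hq : Continuous q) (a lam : ℝ) : dirichletSol q a lam a = 0 := by
  simp [dirichletSol, shootingAngle_self hq]

theorem exists_isSolution_dirichletSol (hq : Continuous q) (a lam : ℝ) :
    ∃ ψ, IsSolution (fun x => q x - lam) a (dirichletSol q a lam) ψ :=
  ⟨_, (isPruferAngle_shootingAngle hq a lam).isSolution (hq.sub continuous_const) a⟩

theorem exists_dirichletSol_ne_zero (hq : Continuous q) (a lam : ℝ) :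
    ∃ x ∈ Ioi a, dirichletSol q a lam x ≠ 0 := by
  obtain ⟨x, hsin, hx⟩ := (((isPruferAngle_shootingAngle hq a lam).frequently_sin_ne_zero
    (a + 1)).and_eventually (Ioi_mem_nhds (lt_add_one a))).exists
  exact ⟨x, hx, mul_ne_zero amplitude_pos.ne' hsin⟩

theorem IsSolution.eq_dirichletSol_smul {E : Type*} [NormedAddCommGroup E] [NormedSpace ℝ E]
    {u v : ℝ → E} (hq : Continuous q) (h : IsSolution (fun x => q x - lam) a u v) (hu : u a = 0)
    {x : ℝ} (hx : a ≤ x) : u x = dirichletSol q a lam x • v a :=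
  (isPruferAngle_shootingAngle hq a lam).eq_amplitude_smul (hq.sub continuous_const) h
    (by simp [shootingAngle_self hq, hu]) (by simp [shootingAngle_self hq]) hx

theorem integrableOn_sq_dirichletSol_iff (hq : Continuous q) (hlim : Tendsto q atTop atTop) :
    IntegrableOn (fun x => dirichletSol q a lam x ^ 2) (Ioi a) ↔ lam ∈ range (level q a) := by
  have hp : Continuous fun x => q x - lam := hq.sub continuous_const
  have hθ := isPruferAngle_shootingAngle hq a lam
  constructor
  · refine fun h_int => (shootingAngle_decays_or_grows hq hlim a lam).resolve_right ?_
    rintro ⟨c, hc, hgrows⟩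
    exact hθ.not_integrableOn_sq_of_grows hp hc hgrows a h_int
  · rintro ⟨i, hi⟩
    exact hθ.integrableOn_sq_of_decays hp
      ((hlim.eventually_ge_atTop (1 + lam)).mono fun x hx => le_sub_iff_add_le.2 hx)
      (sin_succ_mul_pi i) ((decays_iff_eq_level hq hlim).2 hi.symm) a

end DirichletSol

section Primitive

variable {F : Type*} [NormedAddCommGroup F] [NormedSpace ℝ F] {f w : ℝ → F} {a : ℝ}

theorem continuousOn_Ici_of_eq_integral
    (hw : ∀ x, a ≤ x → IntervalIntegrable w volume a x)
    (hf : ∀ x, a ≤ x → f x = f a + ∫ t in a..x, w t) : ContinuousOn f (Ici a) := by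
  intro x hx
  have hax : a ≤ x + 1 := (mem_Ici.1 hx).trans (lt_add_one x).le
  have hcont := (continuousOn_const (c := f a)).add
    (intervalIntegral.continuousOn_primitive_interval' (hw _ hax) left_mem_uIcc)
  rw [uIcc_of_le hax] at hcont
  refine ((hcont x ⟨hx, (lt_add_one x).le⟩).congr (fun z hz => hf z hz.1)
    (hf x hx)).mono_of_mem_nhdsWithin ?_
  rw [← Ici_inter_Iic]
  exact inter_mem self_mem_nhdsWithin
    (mem_nhdsWithin_of_mem_nhds (Iic_mem_nhds (lt_add_one x)))

theorem forall_hasDerivWithinAt_Ici_iff [CompleteSpace F] (hw : ContinuousOn w (Ici a)) :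
    (∀ x ∈ Ici a, HasDerivWithinAt f (w x) (Ici a) x) ↔
      ∀ x, a ≤ x → f x = f a + ∫ t in a..x, w t := by
  constructor
  · intro hf x hx
    rw [intervalIntegral.integral_eq_sub_of_hasDeriv_right_of_le hx
      (fun y hy => ((hf y hy.1).continuousWithinAt).mono Icc_subset_Ici_self)
      (fun y hy => (hf y hy.1.le).mono (Ioi_subset_Ici hy.1.le))
      ((hw.mono Icc_subset_Ici_self).intervalIntegrable_of_Icc hx), add_sub_cancel]
  · intro hf x hx
    have hext : Continuous fun t => w (max a t) :=
      hw.comp_continuous (by fun_prop) fun t => le_max_left a t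
    have hf' : ∀ y ∈ Ici a, f y = f a + ∫ t in a..y, w (max a t) := fun y hy => by
      rw [hf y hy]
      congr 1
      refine intervalIntegral.integral_congr fun t ht => ?_
      rw [uIcc_of_le hy] at ht
      simp only [max_eq_right ht.1]
    have hderiv := ((hasDerivAt_integral_of_continuous hext a x).const_add (f a)).hasDerivWithinAt
      (s := Ici a)
    rw [max_eq_right (mem_Ici.1 hx)] at hderiv
    exact hderiv.congr hf' (hf' x hx)

end Primitive

section Fiber

variable {k lam : ℝ}

theorem fiberOperator_iff {u : ℝ → ℂ} :
    FiberOperator k u (fun x => (lam : ℂ) * u x) ↔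
      MemLp u 2 (volume.restrict (Ioi 0)) ∧ u 0 = 0 ∧
        ∃ v, IsSolution (fun x => (x - k) ^ 2 - lam) 0 u v := by
  have hsmul : ∀ t, (((t - k) ^ 2 : ℝ) : ℂ) * u t - lam * u t = ((t - k) ^ 2 - lam) • u t := by
    intro t
    rw [Complex.real_smul]
    push_cast
    ring
  simp only [FiberOperator, hsmul]
  constructor
  · rintro ⟨hu2, -, v, hu, hv⟩
    have hu0 : u 0 = 0 := by simpa using hu 0 le_rfl
    have hu_int : ∀ x, 0 ≤ x → IntervalIntegrable u volume 0 x := fun x hx => by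
      rw [intervalIntegrable_iff_integrableOn_Ioc_of_le hx]
      exact (hu2.mono_measure (Measure.restrict_mono_set _ Ioc_subset_Ioi_self)).integrable
        one_le_two
    have hvc : ContinuousOn v (Ici 0) := continuousOn_Ici_of_eq_integral
      (fun x hx => (hu_int x hx).continuousOn_smul (by fun_prop)) hv
    have hud : ∀ x ∈ Ici 0, HasDerivWithinAt u (v x) (Ici 0) x :=
      (forall_hasDerivWithinAt_Ici_iff hvc).2 fun x hx => by rw [hu0, zero_add, hu x hx]
    have huc : ContinuousOn u (Ici 0) := fun x hx => (hud x hx).continuousWithinAt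
    exact ⟨hu2, hu0, v, hud, (forall_hasDerivWithinAt_Ici_iff (by fun_prop)).2 hv⟩
  · rintro ⟨hu2, hu0, v, h⟩
    have huc := h.continuousOn_fst
    refine ⟨hu2, hu2.const_mul _, v, fun x hx => ?_,
      (forall_hasDerivWithinAt_Ici_iff (by fun_prop)).1 h.hasDerivWithinAt_snd⟩
    rw [(forall_hasDerivWithinAt_Ici_iff h.continuousOn_snd).1 h.hasDerivWithinAt_fst x hx, hu0,
      zero_add]

theorem integral_sq_dirichletSol_pos {q : ℝ → ℝ} {a : ℝ} (hq : Continuous q)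
    (h_int : IntegrableOn (fun x => dirichletSol q a lam x ^ 2) (Ioi a)) :
    0 < ∫ x in Ioi a, dirichletSol q a lam x ^ 2 := by
  rw [setIntegral_pos_iff_support_of_nonneg_ae (.of_forall fun x => sq_nonneg _) h_int]
  obtain ⟨x, hx, hne⟩ := exists_dirichletSol_ne_zero hq a lam
  exact ((((continuous_dirichletSol hq a lam).pow 2).isOpen_support).inter
    isOpen_Ioi).measure_pos volume ⟨x, pow_ne_zero 2 hne, hx⟩

theorem mem_eigenvalues_iff :
    lam ∈ eigenvalues k ↔
      IntegrableOn (fun x => dirichletSol (fun x => (x - k) ^ 2) 0 lam x ^ 2) (Ioi 0) := by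
  have hq : Continuous fun x : ℝ => (x - k) ^ 2 := by fun_prop
  set S : ℝ → ℝ := dirichletSol (fun x => (x - k) ^ 2) 0 lam
  constructor
  · rintro ⟨u, hop, hnorm⟩
    obtain ⟨hu2, hu0, v, h⟩ := fiberOperator_iff.1 hop
    have hsq : EqOn (fun x => ‖u x‖ ^ 2) (fun x => S x ^ 2 * ‖v 0‖ ^ 2) (Ioi 0) := fun x hx => by
      simp only [h.eq_dirichletSol_smul hq hu0 (mem_Ioi.1 hx).le, norm_smul, mul_pow,
        Real.norm_eq_abs, sq_abs, S]
    rw [setIntegral_congr_fun measurableSet_Ioi hsq, integral_mul_const] at hnorm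
    have h_int : IntegrableOn (fun x => S x ^ 2 * ‖v 0‖ ^ 2) (Ioi 0) :=
      (integrableOn_congr_fun hsq measurableSet_Ioi).1
        ((memLp_two_iff_integrable_sq_norm hu2.1).1 hu2)
    exact (integrable_mul_const_iff (right_ne_zero_of_mul_eq_one hnorm).isUnit _).1 h_int
  · intro h_int
    obtain ⟨ψ, hψ⟩ := exists_isSolution_dirichletSol hq 0 lam
    set N := ∫ x in Ioi 0, S x ^ 2
    have hN : 0 < N := integral_sq_dirichletSol_pos hq h_int
    have hS2 : MemLp (fun x => S x • ((√N)⁻¹ : ℂ)) 2 (volume.restrict (Ioi 0)) := by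
      have hS : MemLp S 2 (volume.restrict (Ioi 0)) :=
        (memLp_two_iff_integrable_sq
          (continuous_dirichletSol hq 0 lam).aestronglyMeasurable).2 h_int
      exact (Complex.ofRealCLM.comp_memLp' hS).mul_const ((√N)⁻¹ : ℂ)
    refine ⟨fun x => S x • ((√N)⁻¹ : ℂ), fiberOperator_iff.2
      ⟨hS2, by simp [S, dirichletSol_self hq], _, hψ.smul_const _⟩, ?_⟩
    calc ∫ x in Ioi 0, ‖S x • ((√N)⁻¹ : ℂ)‖ ^ 2 = ∫ x in Ioi 0, S x ^ 2 * N⁻¹ := by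
          simp [mul_pow, sq_sqrt hN.le]
      _ = 1 := by rw [integral_mul_const, mul_inv_cancel₀ hN.ne']

theorem tendsto_sub_sq_atTop (k : ℝ) : Tendsto (fun x : ℝ => (x - k) ^ 2) atTop atTop :=
  (tendsto_pow_atTop two_ne_zero).comp (tendsto_atTop_add_const_right _ (-k) tendsto_id)

theorem eigenvalues_eq_range (k : ℝ) :
    eigenvalues k = range (level (fun x => (x - k) ^ 2) 0) :=
  ext fun _ => mem_eigenvalues_iff.trans
    (integrableOn_sq_dirichletSol_iff (by fun_prop) (tendsto_sub_sq_atTop k))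

theorem bandFun_succ (i : ℕ) (k : ℝ) : bandFun (i + 1) k = level (fun x => x ^ 2) (-k) i := by
  rw [bandFun, eigenvalues_eq_range, sInf_range_encard_eq
    (level_strictMono (by fun_prop) (tendsto_sub_sq_atTop k) 0),
    level_comp_sub (q := fun x => x ^ 2) (by fun_prop), zero_sub]

theorem strictAnti_bandFun (i : ℕ) : StrictAnti (bandFun (i + 1)) := fun k₁ k₂ h => by
  rw [bandFun_succ, bandFun_succ]
  exact level_lt_level_of_lt (by fun_prop) (tendsto_pow_atTop two_ne_zero) (neg_lt_neg h) i

end Fiber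

section Oscillation

theorem exists_polar_angle (y z : ℝ) :
    ∃ r s : ℝ, 0 < s ∧ s ≤ π ∧ y = sin s * r ∧ z = cos s * r := by
  have hcos : ‖(⟨z, y⟩ : ℂ)‖ * cos (Complex.arg ⟨z, y⟩) = z := Complex.norm_mul_cos_arg _
  have hsin : ‖(⟨z, y⟩ : ℂ)‖ * sin (Complex.arg ⟨z, y⟩) = y := Complex.norm_mul_sin_arg _
  rcases lt_or_ge 0 (Complex.arg ⟨z, y⟩) with h | h
  · exact ⟨_, _, h, Complex.arg_le_pi _, by rw [mul_comm, hsin], by rw [mul_comm, hcos]⟩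
  · refine ⟨-‖(⟨z, y⟩ : ℂ)‖, Complex.arg ⟨z, y⟩ + π, by linarith [Complex.neg_pi_lt_arg ⟨z, y⟩],
      by linarith, ?_, ?_⟩
    · rw [sin_add_pi]; linarith
    · rw [cos_add_pi]; linarith

theorem succ_le_encard_zeros {p θ φ ψ : ℝ → ℝ} {a : ℝ} {i : ℕ} {r x : ℝ} (hp : Continuous p)
    (hθ : IsPruferAngle p θ) (h : IsSolution p a φ ψ) (hφ : φ a = sin (θ a) * r)
    (hψ : ψ a = cos (θ a) * r) (ha : θ a ≤ π) (hax : a ≤ x) (hx : (i + 1) * π ≤ θ x) :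
    ((i + 1 : ℕ) : ℕ∞) ≤ {x ∈ Ici a | φ x = 0}.encard := by
  have hinj : Function.Injective fun j : ℕ => (j + 1) * π := fun j l hjl => by
    simpa [pi_ne_zero] using hjl
  have hhit : (fun j : ℕ => (j + 1) * π) '' Iio (i + 1) ⊆ θ '' {x ∈ Ici a | φ x = 0} := by
    rintro _ ⟨j, hj, rfl⟩
    have hji : (j : ℝ) ≤ i := by exact_mod_cast Nat.lt_succ_iff.1 hj
    have hjx : (j + 1) * π ≤ (i + 1) * π := by gcongr
    obtain ⟨t, ht, htj⟩ := intermediate_value_Icc hax hθ.continuous.continuousOn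
      ⟨ha.trans (pi_le_succ_mul_pi j), hjx.trans hx⟩
    refine ⟨t, ⟨ht.1, ?_⟩, htj⟩
    rw [hθ.eq_amplitude_smul hp h hφ hψ ht.1, htj, sin_succ_mul_pi, mul_zero, zero_smul]
  calc ((i + 1 : ℕ) : ℕ∞) = ((fun j : ℕ => (j + 1) * π) '' Iio (i + 1)).encard := by
        rw [hinj.encard_image, ← Finset.coe_range, encard_coe_eq_coe_finsetCard, Finset.card_range]
    _ ≤ (θ '' {x ∈ Ici a | φ x = 0}).encard := encard_le_encard hhit
    _ ≤ _ := encard_image_le _ _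

theorem lt_level_of_encard_zeros_le {q φ ψ : ℝ → ℝ} {a lam : ℝ} {i : ℕ} (hq : Continuous q)
    (hlim : Tendsto q atTop atTop) (h : IsSolution (fun x => q x - lam) a φ ψ)
    (hzeros : {x ∈ Ici a | φ x = 0}.encard ≤ i) : lam < level q a i := by
  by_contra! hle
  have hp : Continuous fun x => q x - lam := hq.sub continuous_const
  obtain ⟨r, s, hs, hsπ, hr, hr'⟩ := exists_polar_angle (φ a) (ψ a)
  obtain ⟨θ, rfl, hθ⟩ := exists_isPruferAngle hp a s
  obtain ⟨x, hax, hx⟩ := (level_decays hq hlim a i).exists_ge_of_lt (hq.sub continuous_const)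
    (isPruferAngle_shootingAngle hq a _) hθ (fun _ => sub_le_sub_left hle _) (sin_succ_mul_pi i)
    (by rwa [shootingAngle_self hq])
  have hcard := (succ_le_encard_zeros hp hθ h hr hr' hsπ hax hx).trans hzeros
  exact absurd (Nat.cast_le.1 hcard) (Nat.not_succ_le_self i)

end Oscillation

section Hermite

open Polynomial

theorem derivative_hermite_succ (n : ℕ) :
    derivative (hermite (n + 1)) = (n + 1 : ℤ[X]) * hermite n := by
  induction n with
  | zero => simp
  | succ n ih =>
    rw [hermite_succ, derivative_sub, derivative_mul, ih, derivative_mul]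
    simp only [derivative_X, hermite_succ, one_mul, derivative_add, derivative_natCast,
      derivative_one, add_zero, zero_mul, zero_add, Nat.cast_add, Nat.cast_one]
    ring

theorem derivative_derivative_hermite (n : ℕ) :
    derivative (derivative (hermite n)) = X * derivative (hermite n) - (n : ℤ[X]) * hermite n := by
  have hderiv : derivative (hermite n) = X * hermite n - hermite (n + 1) := by
    rw [hermite_succ]; ring
  nth_rw 1 [hderiv]
  rw [derivative_sub, derivative_mul, derivative_X, derivative_hermite_succ]
  ring

/-- The Hermite function `H_n(√2 x) exp(-x²/2)`, with `H_n` the probabilists' polynomial. -/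
def hermiteFun (n : ℕ) (x : ℝ) : ℝ := aeval (√2 * x) (hermite n) * exp (-(x ^ 2 / 2))

theorem exists_isSolution_hermiteFun (n : ℕ) (a : ℝ) :
    ∃ ψ, IsSolution (fun x => x ^ 2 - (2 * n + 1)) a (hermiteFun n) ψ := by
  have hgauss : ∀ x : ℝ, HasDerivAt (fun x => exp (-(x ^ 2 / 2))) (exp (-(x ^ 2 / 2)) * -x) x :=
    fun x => (((hasDerivAt_id x).fun_pow 2).div_const 2).fun_neg.exp.congr_deriv (by simp)
  have hpoly : ∀ (P : ℤ[X]) (x : ℝ), HasDerivAt (fun x => aeval (√2 * x) P)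
      (aeval (√2 * x) (derivative P) * √2) x := fun P x =>
    (P.hasDerivAt_aeval (√2 * x)).comp x (hasDerivAt_const_mul √2)
  have hsqrt : √2 * √2 = 2 := mul_self_sqrt zero_le_two
  refine ⟨fun x => (aeval (√2 * x) (derivative (hermite n)) * √2 -
      x * aeval (√2 * x) (hermite n)) * exp (-(x ^ 2 / 2)),
    fun x _ => (((hpoly (hermite n) x).fun_mul (hgauss x)).congr_deriv (by ring)).hasDerivWithinAt,
    fun x _ => (HasDerivAt.congr_deriv ((((hpoly (derivative (hermite n)) x).mul_const √2).fun_sub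
      ((hasDerivAt_id x).fun_mul (hpoly (hermite n) x))).fun_mul (hgauss x)) ?_).hasDerivWithinAt⟩
  have hode := congrArg (aeval (√2 * x)) (derivative_derivative_hermite n)
  simp only [map_sub, map_mul, aeval_X, map_natCast] at hode
  rw [hode, hermiteFun, id, smul_eq_mul]
  linear_combination exp (-(x ^ 2 / 2)) * (√2 * x * aeval (√2 * x) (derivative (hermite n))
    - n * aeval (√2 * x) (hermite n)) * hsqrt

theorem encard_zeros_hermiteFun_le (n : ℕ) (s : Set ℝ) :
    {x ∈ s | hermiteFun n x = 0}.encard ≤ n := by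
  have hinj : Function.Injective fun x : ℝ => √2 * x := mul_right_injective₀ (by simp)
  have hmaps : (fun x => √2 * x) '' {x ∈ s | hermiteFun n x = 0} ⊆ (hermite n).rootSet ℝ := by
    rintro _ ⟨x, ⟨-, hx⟩, rfl⟩
    exact (mem_rootSet_of_ne (hermite_monic n).ne_zero).2
      ((mul_eq_zero.1 hx).resolve_right (exp_ne_zero _))
  calc {x ∈ s | hermiteFun n x = 0}.encard ≤ ((hermite n).rootSet ℝ).encard :=
        hinj.encard_image _ ▸ encard_le_encard hmaps
    _ ≤ n := by
        rw [← ((hermite n).rootSet_finite ℝ).cast_ncard_eq]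
        exact_mod_cast ((hermite n).ncard_rootSet_le ℝ).trans_eq natDegree_hermite

end Hermite

theorem landau_lt_bandFun (i : ℕ) (k : ℝ) : landau (i + 1) < bandFun (i + 1) k := by
  obtain ⟨ψ, hψ⟩ := exists_isSolution_hermiteFun i (-k)
  have hlandau : landau (i + 1) = 2 * i + 1 := by rw [landau]; push_cast; ring
  rw [bandFun_succ, hlandau]
  exact lt_level_of_encard_zeros_le (by fun_prop) (tendsto_pow_atTop two_ne_zero) hψ
    (encard_zeros_hermiteFun_le i _)

theorem bandInv_bandFun (i : ℕ) (k : ℝ) : bandInv (i + 1) (bandFun (i + 1) k) = k :=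
  Function.leftInverse_invFun (strictAnti_bandFun i).injective k

theorem wWeight_mul_fourierCoefficient (u : ℕ → ℝ → ℝ → ℂ) (i : ℕ) (α : ℝ) (f : ℝ × ℝ → ℂ)
    (k : ℝ) :
    (wWeight (i + 1) α k : ℂ) * fourierCoefficient u (i + 1) f k =
      (bandFun (i + 1) k - landau (i + 1)) ^ (-α) •
        weightedCoefficient u (i + 1) f (bandFun (i + 1) k) := by
  rw [wWeight, weightedCoefficient, muWeight, bandInv_bandFun,
    abs_of_pos (sub_pos.2 (landau_lt_bandFun i k)), Complex.real_smul]
  push_cast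
  ring

theorem IsHolderSpace.exists_norm_rpow_smul_le {α a : ℝ} (hα : 0 ≤ α) {g : ℝ → ℂ}
    (hg : IsHolderSpace α (Ici a) g) (h0 : g a = 0) :
    ∃ C : ℝ, ∀ x, a < x → ‖(x - a) ^ (-α) • g x‖ ≤ C := by
  obtain ⟨-, -, C, hC⟩ := hg
  refine ⟨C, fun x hx => ?_⟩
  have hpos : 0 < x - a := sub_pos.2 hx
  have hdist := hC.dist_le (mem_Ici.2 hx.le) (mem_Ici.2 le_rfl)
  rw [h0, dist_zero_right, dist_eq, abs_of_pos hpos, coe_toNNReal α hα] at hdist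
  calc ‖(x - a) ^ (-α) • g x‖ = (x - a) ^ (-α) * ‖g x‖ := by
        rw [norm_smul, norm_of_nonneg (by positivity)]
    _ ≤ (x - a) ^ (-α) * (C * (x - a) ^ α) := by gcongr
    _ = C := by
        rw [mul_left_comm, ← rpow_add hpos, neg_add_cancel, rpow_zero, mul_one]

theorem measurable_comp_of_continuousOn {X Y Z : Type*} [MeasurableSpace X] [TopologicalSpace Y]
    [MeasurableSpace Y] [OpensMeasurableSpace Y] [TopologicalSpace Z] [MeasurableSpace Z]
    [BorelSpace Z] {S : Set Y} {b : X → Y} {g : Y → Z} (hg : ContinuousOn g S)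
    (hb : Measurable b) (hS : ∀ x, b x ∈ S) : Measurable fun x => g (b x) :=
  hg.domRestrict.measurable.comp (hb.subtype_mk (h := hS))

end HalfPlane

end

theorem proposition3p1_general (u : ℕ → ℝ → ℝ → ℂ) (_hu : HalfPlane.IsEigenfunctionFamily u)
    (n : ℕ) (hn : 1 ≤ n) (s : ℝ) (_hs : 1 / 2 < s) (α : ℝ) (hα0 : 0 ≤ α)
    (f : ℝ × ℝ → ℂ) (hf : f ∈ HalfPlane.absorptionSpace u n s α) :
    MemLp (fun k : ℝ => (HalfPlane.wWeight n α k : ℂ) * HalfPlane.fourierCoefficient u n f k)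
        ⊤ volume ∧
      ∃ C : ℝ, ∀ k : ℝ,
        ‖(HalfPlane.wWeight n α k : ℂ) * HalfPlane.fourierCoefficient u n f k‖ ≤ C := by
  obtain ⟨-, -, g, hg, hgH, hg0⟩ := hf
  obtain ⟨i, rfl⟩ := Nat.exists_eq_add_of_le' hn
  have hgt := HalfPlane.landau_lt_bandFun i
  simp only [HalfPlane.wWeight_mul_fourierCoefficient, ← hg _ (hgt _)]
  obtain ⟨C, hC⟩ := hgH.exists_norm_rpow_smul_le hα0 hg0
  refine ⟨memLp_top_of_bound ?_ C (.of_forall fun k => hC _ (hgt k)), C, fun k => hC _ (hgt k)⟩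
  have hband : Measurable (HalfPlane.bandFun (i + 1)) :=
    (HalfPlane.strictAnti_bandFun i).antitone.measurable
  exact (((hband.sub_const _).pow_const _).smul (HalfPlane.measurable_comp_of_continuousOn hgH.1
    hband fun k => (hgt k).le)).aestronglyMeasurable

theorem proposition3p1 (u : ℕ → ℝ → ℝ → ℂ) (hu : HalfPlane.IsEigenfunctionFamily u)
    (n : ℕ) (hn : 1 ≤ n) (s : ℝ) (hs : 1 / 2 < s)
    (α : ℝ) (hα0 : 0 ≤ α) (hα : α < min 1 (s - 1 / 2))
    (f : ℝ × ℝ → ℂ) (hf : f ∈ HalfPlane.absorptionSpace u n s α) :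
    MemLp (fun k : ℝ => (HalfPlane.wWeight n α k : ℂ) * HalfPlane.fourierCoefficient u n f k)
        ⊤ volume ∧
      ∃ C : ℝ, ∀ k : ℝ,
        ‖(HalfPlane.wWeight n α k : ℂ) * HalfPlane.fourierCoefficient u n f k‖ ≤ C :=
  proposition3p1_general u hu n hn s hs α hα0 f hf
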